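/- Let $\sigma=\mathrm{Prop}\cup\{R_i\mid i\in I\}$ be a modal signature with a finite set $\mathrm{Prop}$ of unary proposition letters and finitely many binary actions $R_i$ ($i\in I$). A $\sigma$-LTS $M_a$ is a (possibly infinite) $\sigma$-structure $M$ with one distinguished state $a$. It is degree-finite if every state has only finitely many successors and only finitely many predecessors along the actions, and connected if any two distinct states are joined by a finite path of transitions, each of which may be traversed in either direction. Let $\mathcal C_\sigma$ be the class of all finite connected $\sigma$-LTSs. A homomorphism $T_c\to M_a$ is a map $\mathrm{dom}(T)\to\mathrm{dom}(M)$ that sends $c$ to $a$ and preserves all proposition letters and all actions; $\mathrm{Hom}(T_c,M_a)$ is the set of these maps, and $\hom_{\mathbb N}(T_c,M_a)=|\mathrm{Hom}(T_c,M_a)|$ when this set is finite. Formulas of hybrid logic $\mathrm{HL}^B(\downarrow,@)$ with backward modalities are generated by $$\varphi ::= p\mid x\mid \varphi\wedge\varphi\mid\varphi\vee\varphi\mid\neg\varphi\mid\Diamond_i\varphi\mid\Box_i\varphi\mid\blacklozenge_i\varphi\mid\;\downarrow x.\,\varphi\mid @_x\varphi,$$ where $p\in\mathrm{Prop}$, $i\in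 I$ and $x$ ranges over a countably infinite set of world variables (there are no nominals). With respect to an assignment $g$ of states to world variables, the propositional letters, Boolean connectives and forward modalities are interpreted as usual at the current state $m$; $\blacklozenge_i\varphi$ holds at $m$ iff $\varphi$ holds at some $n$ with $R_i(n,m)$; $x$ holds at $m$ iff $g(x)=m$; $\downarrow x.\,\varphi$ holds at $m$ under $g$ iff $\varphi$ holds at $m$ under $g[x\mapsto m]$; and $@_x\varphi$ holds at $m$ iff $\varphi$ holds at $g(x)$. A sentence is a formula without free world variables, and $M_a\models\varphi$ means that the sentence $\varphi$ holds at $a$. Write $M_a\equiv_{\mathrm{HL}^B(\downarrow,@)}N_b$ if $M_a$ and $N_b$ satisfy the same sentences. **Theorem.** Let $M_a$ and $N_b$ be degree-finite $\sigma$-LTSs. Then $\mathrm{Hom}(T_c,M_a)$ and $\mathrm{Hom}(T_c,N_b)$ are finite for every $T_c\in\mathcal C_\sigma$, and $$M_a\equiv_{\mathrm{HL}^B(\downarrow,@)}N_b\iff \hom_{\mathbb N}(T_c,M_a)=\hom_{\mathbb N}(T_c,N_b)\ \text{ for all } T_c\in\mathcal C_\sigma.$$ -/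

import Mathlib

universe u v w

/-- A labeled transition system over the modal signature with proposition letters `P` and actions
`R_i`, `i : I`: a first-order structure with one distinguished element. -/
structure LTS (P : Type u) (I : Type v) : Type (max u v (w + 1)) where
  /-- the set of states -/
  Dom : Type w
  /-- `val p m`: the proposition letter `p` holds at the state `m` -/
  val : P → Dom → Prop
  /-- `rel i m n`: there is an `R_i` transition from `m` to `n` -/
  rel : I → Dom → Dom → Prop
  /-- the distinguished state -/
  pt : Dom

namespace LTS

variable {P : Type*} {I : Type*}

/-- The set of successors of a state (along any action). -/
def Succ (M : LTS P I) (m : M.Dom) : Set M.Dom := {n | ∃ i, M.rel i m n}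

/-- The set of predecessors of a state (along any action). -/
def Pred (M : LTS P I) (m : M.Dom) : Set M.Dom := {n | ∃ i, M.rel i n m}

/-- Every state has finitely many successors and finitely many predecessors. -/
def DegreeFinite (M : LTS P I) : Prop :=
  ∀ m : M.Dom, (M.Succ m).Finite ∧ (M.Pred m).Finite

/-- Two states occur together in a transition, in one of the two directions. -/
def Step (M : LTS P I) (m n : M.Dom) : Prop := ∃ i, M.rel i m n ∨ M.rel i n m

/-- Any two states are joined by a finite path of transitions, each of which may be traversed
in either direction. -/
def Connected (M : LTS P I) : Prop :=
  ∀ m n : M.Dom, Relation.ReflTransGen M.Step m n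

/-- Homomorphisms of pointed structures. -/
structure IsHom (T : LTS P I) (M : LTS P I) (h : T.Dom → M.Dom) : Prop where
  map_pt : h T.pt = M.pt
  map_val : ∀ (p : P) (s : T.Dom), T.val p s → M.val p (h s)
  map_rel : ∀ (i : I) (s t : T.Dom), T.rel i s t → M.rel i (h s) (h t)

/-- The set `Hom(T, M)` of homomorphisms from `T` to `M`. -/
def HomSet (T : LTS P I) (M : LTS P I) : Set (T.Dom → M.Dom) := {h | IsHom T M h}

/-- The homomorphism count `|Hom(T, M)|` over the semiring of natural numbers
(meaningful only if `Hom(T, M)` is finite). -/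
noncomputable def homCount (T : LTS P I) (M : LTS P I) : ℕ := (HomSet T M).ncard

/-- The class of finite connected LTSs; up to isomorphism every finite LTS has its states in a
`Type`. -/
def finiteConnected (P : Type*) (I : Type*) : Set (LTS.{_, _, 0} P I) :=
  {T | Finite T.Dom ∧ T.Connected}

/-- The left homomorphism vector of `M` over the natural numbers, restricted to the class `C`. -/
noncomputable def homVector (C : Set (LTS.{_, _, 0} P I)) (M : LTS P I) : C → ℕ :=
  fun T => homCount T.1 M

end LTS

/-- Formulas of the hybrid logic `HL(↓,@)` with backward modalities (and without nominals);
the world variables are indexed by `ℕ`. -/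
inductive HLB (P : Type u) (I : Type v) : Type (max u v)
  /-- a proposition letter -/
  | prop (p : P)
  /-- a world variable -/
  | wvar (x : ℕ)
  | conj (φ ψ : HLB P I)
  | disj (φ ψ : HLB P I)
  | neg (φ : HLB P I)
  /-- the forward diamond of the action `R_i` -/
  | dia (i : I) (φ : HLB P I)
  /-- the forward box of the action `R_i` -/
  | box (i : I) (φ : HLB P I)
  /-- the backward diamond of the action `R_i` -/
  | bdia (i : I) (φ : HLB P I)
  /-- the binder `↓x. φ` -/
  | bind (x : ℕ) (φ : HLB P I)
  /-- the satisfaction operator `@_x φ` -/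
  | atVar (x : ℕ) (φ : HLB P I)

namespace HLB

variable {P : Type*} {I : Type*}

/-- The world variables with a free occurrence in a formula. -/
def freeVars : HLB P I → Set ℕ
  | prop _ => ∅
  | wvar x => {x}
  | conj φ ψ => φ.freeVars ∪ ψ.freeVars
  | disj φ ψ => φ.freeVars ∪ ψ.freeVars
  | neg φ => φ.freeVars
  | dia _ φ => φ.freeVars
  | box _ φ => φ.freeVars
  | bdia _ φ => φ.freeVars
  | bind x φ => φ.freeVars \ {x}
  | atVar x φ => {x} ∪ φ.freeVars

/-- A sentence has no free world variables. -/
def IsSentence (φ : HLB P I) : Prop := φ.freeVars = ∅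

/-- Satisfaction of a formula at the state `a` of `M` under the assignment `g`. -/
def Sat (M : LTS P I) : M.Dom → (ℕ → M.Dom) → HLB P I → Prop
  | a, _, prop p => M.val p a
  | a, g, wvar x => g x = a
  | a, g, conj φ ψ => Sat M a g φ ∧ Sat M a g ψ
  | a, g, disj φ ψ => Sat M a g φ ∨ Sat M a g ψ
  | a, g, neg φ => ¬ Sat M a g φ
  | a, g, dia i φ => ∃ b, M.rel i a b ∧ Sat M b g φ
  | a, g, box i φ => ∀ b, M.rel i a b → Sat M b g φ
  | a, g, bdia i φ => ∃ b, M.rel i b a ∧ Sat M b g φ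
  | a, g, bind x φ => Sat M a (Function.update g x a) φ
  | _, g, atVar x φ => Sat M (g x) g φ

/-- Satisfaction depends only on the values of the assignment at the free variables. -/
theorem sat_congr (M : LTS P I) (φ : HLB P I) : ∀ (a : M.Dom) (g g' : ℕ → M.Dom),
    (∀ x ∈ φ.freeVars, g x = g' x) → (Sat M a g φ ↔ Sat M a g' φ) := by
  induction φ with
  | prop p => intro a g g' _; rfl
  | wvar x => intro a g g' h; simp only [Sat, h x rfl]
  | conj φ ψ ih1 ih2 =>
    intro a g g' h
    simp only [Sat]
    rw [ih1 a g g' fun x hx => h x (Or.inl hx), ih2 a g g' fun x hx => h x (Or.inr hx)]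
  | disj φ ψ ih1 ih2 =>
    intro a g g' h
    simp only [Sat]
    rw [ih1 a g g' fun x hx => h x (Or.inl hx), ih2 a g g' fun x hx => h x (Or.inr hx)]
  | neg φ ih => intro a g g' h; simp only [Sat]; rw [ih a g g' h]
  | dia i φ ih => intro a g g' h; simp only [Sat, ih _ g g' h]
  | box i φ ih => intro a g g' h; simp only [Sat, ih _ g g' h]
  | bdia i φ ih => intro a g g' h; simp only [Sat, ih _ g g' h]
  | bind x φ ih =>
    intro a g g' h
    simp only [Sat]
    refine ih a _ _ fun y hy => ?_
    by_cases hxy : y = x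
    · simp [hxy]
    · simp only [Function.update_of_ne hxy]; exact h y ⟨hy, hxy⟩
  | atVar x φ ih =>
    intro a g g' h
    simp only [Sat]
    rw [h x (Or.inl rfl)]
    exact ih _ g g' fun y hy => h y (Or.inr hy)

/-- Truth of a sentence in an LTS. -/
def Models (M : LTS P I) (φ : HLB P I) : Prop := ∀ g : ℕ → M.Dom, Sat M M.pt g φ

/-- For a sentence the chosen assignment does not matter. -/
theorem models_iff_sat (M : LTS P I) (φ : HLB P I) (hφ : φ.IsSentence) (g : ℕ → M.Dom) :
    Models M φ ↔ Sat M M.pt g φ := by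
  refine ⟨fun h => h g, fun h g' => (sat_congr M φ M.pt g g' fun x hx => ?_).1 h⟩
  rw [IsSentence] at hφ
  simp [hφ] at hx

/-- `M` and `N` satisfy the same sentences. -/
def Equivalent (M : LTS P I) (N : LTS P I) : Prop :=
  ∀ φ : HLB P I, φ.IsSentence → (Models M φ ↔ Models N φ)

end HLB

/-!
Both sides of the equivalence say that every finite ball around one distinguished point embeds into
the other structure and vice versa; two finite structures that embed into each other are isomorphic.

From the logic to embeddings: `↓` stores the current state in a variable and `@` jumps back to it,
so by the Hennessy–Milner argument the states of a ball in `M` can be visited and stored one after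
the other while states of `N` are stored that satisfy the same formulas. Conversely, a formula of
modal depth `r` cannot see beyond the ball of radius `r`.

From homomorphism counts to embeddings: sorting homomorphisms by their kernels gives Lovász'
recursion, which recovers the numbers of injective homomorphisms from the numbers of
homomorphisms. Conversely, a homomorphism from a finite connected structure stays in a finite ball.
-/

namespace LTS

variable {P I : Type*}

section Balls

theorem Step.symm {M : LTS P I} {m n : M.Dom} (h : M.Step m n) : M.Step n m :=
  h.imp fun _ => Or.symm

/-- The ball of radius `n` around the distinguished state, for the distance that counts transitions
traversed in either direction. -/
def ball (M : LTS P I) : ℕ → Set M.Dom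
  | 0 => {M.pt}
  | n + 1 => M.ball n ∪ {y | ∃ x ∈ M.ball n, M.Step x y}

variable {M T : LTS P I}

theorem ball_mono (M : LTS P I) : Monotone M.ball :=
  monotone_nat_of_le_succ fun _ => Set.subset_union_left

theorem pt_mem_ball (M : LTS P I) (n : ℕ) : M.pt ∈ M.ball n :=
  M.ball_mono n.zero_le rfl

theorem Step.mem_ball {x y : M.Dom} {n : ℕ} (h : M.Step x y) (hx : x ∈ M.ball n) :
    y ∈ M.ball (n + 1) :=
  Or.inr ⟨x, hx, h⟩

theorem DegreeFinite.finite_ball (hM : M.DegreeFinite) (n : ℕ) : (M.ball n).Finite := by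
  induction n with
  | zero => exact Set.finite_singleton M.pt
  | succ n ih =>
    refine ih.union ((ih.biUnion fun x _ => (hM x).1.union (hM x).2).subset ?_)
    rintro y ⟨x, hx, i, hi⟩
    exact Set.mem_biUnion hx (hi.imp (⟨i, ·⟩) (⟨i, ·⟩))

theorem reflTransGen_step_of_mem_ball {x : M.Dom} {n : ℕ} (hx : x ∈ M.ball n) :
    Relation.ReflTransGen M.Step M.pt x := by
  induction n generalizing x with
  | zero => exact hx ▸ .refl
  | succ n ih =>
    rcases hx with hx | ⟨w, hw, hwx⟩
    exacts [ih hx, (ih hw).tail hwx]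

theorem exists_mem_ball_of_reflTransGen {x : M.Dom} (h : Relation.ReflTransGen M.Step M.pt x) :
    ∃ n, x ∈ M.ball n := by
  induction h with
  | refl => exact ⟨0, rfl⟩
  | tail _ hstep ih => exact ih.imp' (· + 1) fun _ => hstep.mem_ball

theorem Connected.exists_forall_mem_ball [Finite T.Dom] (hT : T.Connected) :
    ∃ r, ∀ t, t ∈ T.ball r := by
  choose n hn using fun t => exists_mem_ball_of_reflTransGen (hT T.pt t)
  obtain ⟨r, hr⟩ := (Set.finite_range n).bddAbove
  exact ⟨r, fun t => T.ball_mono (hr ⟨t, rfl⟩) (hn t)⟩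

theorem connected_of_forall_mem_ball {r : ℕ} (h : ∀ t, t ∈ T.ball r) : T.Connected := fun s t =>
  have : Std.Symm T.Step := ⟨fun _ _ => Step.symm⟩
  (symm (reflTransGen_step_of_mem_ball (h s))).trans (reflTransGen_step_of_mem_ball (h t))

end Balls

section Homomorphisms

variable {S T M : LTS P I}

namespace IsHom

theorem comp {g : T.Dom → M.Dom} {f : S.Dom → T.Dom} (hg : IsHom T M g) (hf : IsHom S T f) :
    IsHom S M (g ∘ f) where
  map_pt := (congrArg g hf.map_pt).trans hg.map_pt
  map_val p s h := hg.map_val p _ (hf.map_val p s h)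
  map_rel i s t h := hg.map_rel i _ _ (hf.map_rel i s t h)

theorem map_step {h : T.Dom → M.Dom} (hh : IsHom T M h) {s t : T.Dom} (hst : T.Step s t) :
    M.Step (h s) (h t) :=
  hst.imp fun i => Or.imp (hh.map_rel i s t) (hh.map_rel i t s)

theorem map_mem_ball {h : T.Dom → M.Dom} (hh : IsHom T M h) {t : T.Dom} {n : ℕ}
    (ht : t ∈ T.ball n) : h t ∈ M.ball n := by
  induction n generalizing t with
  | zero => exact (congrArg h ht).trans hh.map_pt
  | succ n ih =>
    rcases ht with ht | ⟨s, hs, hst⟩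
    exacts [Or.inl (ih ht), (hh.map_step hst).mem_ball (ih hs)]

theorem connected_of_surjective {h : T.Dom → M.Dom} (hh : IsHom T M h)
    (hsurj : Function.Surjective h) (hT : T.Connected) : M.Connected :=
  hsurj.forall₂.2 fun s t => (hT s t).lift h fun _ _ => hh.map_step

end IsHom

theorem DegreeFinite.finite_homSet (hM : M.DegreeFinite) [Finite T.Dom] (hT : T.Connected) :
    (HomSet T M).Finite := by
  obtain ⟨r, hr⟩ := hT.exists_forall_mem_ball
  exact (Set.Finite.pi' fun _ : T.Dom => hM.finite_ball r).subset fun _ hh t =>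
    hh.map_mem_ball (hr t)

/-- The set of injective homomorphisms from `T` to `M`. -/
def InjHomSet (T M : LTS P I) : Set (T.Dom → M.Dom) := {h | IsHom T M h ∧ Function.Injective h}

theorem injHomSet_subset_homSet (T M : LTS P I) : InjHomSet T M ⊆ HomSet T M := fun _ h => h.1

theorem comp_mem_injHomSet {g : T.Dom → M.Dom} {f : S.Dom → T.Dom} (hg : g ∈ InjHomSet T M)
    (hf : f ∈ InjHomSet S T) : g ∘ f ∈ InjHomSet S M :=
  ⟨hg.1.comp hf.1, hg.2.comp hf.2⟩

theorem homCount_le_of_mem_injHomSet {u : S.Dom → M.Dom} (hu : u ∈ InjHomSet S M)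
    (hfin : (HomSet T M).Finite) : homCount T S ≤ homCount T M :=
  Set.ncard_le_ncard_of_injOn (u ∘ ·) (fun _ hh => hu.1.comp hh) hu.2.comp_left.injOn hfin

end Homomorphisms

section InducedStructures

variable {T M N : LTS P I}

/-- The structure on `K` induced along a map `f : K → M.Dom`, with distinguished state `k`. -/
def comap (M : LTS P I) {K : Type*} (f : K → M.Dom) (k : K) : LTS P I where
  Dom := K
  val p s := M.val p (f s)
  rel i s t := M.rel i (f s) (f t)
  pt := k

theorem isHom_comap {K : Type*} {f : K → M.Dom} {k : K} (hk : f k = M.pt) :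
    IsHom (M.comap f k) M f :=
  ⟨hk, fun _ _ => id, fun _ _ _ => id⟩

/-- The substructure of `M` on the ball of radius `r` around the distinguished state. -/
def neighborhood (M : LTS P I) (r : ℕ) : LTS P I :=
  M.comap (Subtype.val : M.ball r → M.Dom) ⟨M.pt, M.pt_mem_ball r⟩

theorem val_mem_injHomSet_neighborhood (M : LTS P I) (r : ℕ) :
    (Subtype.val : M.ball r → M.Dom) ∈ InjHomSet (M.neighborhood r) M :=
  ⟨isHom_comap rfl, Subtype.val_injective⟩

theorem mem_ball_neighborhood {r n : ℕ} (hn : n ≤ r) {x : (M.neighborhood r).Dom}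
    (hx : x.1 ∈ M.ball n) : x ∈ (M.neighborhood r).ball n := by
  induction n generalizing x with
  | zero => exact Subtype.ext hx
  | succ n ih =>
    rcases hx with hx | ⟨w, hw, hwx⟩
    · exact Or.inl (ih (by lia) hx)
    · exact Or.inr ⟨⟨w, M.ball_mono (by lia) hw⟩, ih (by lia) hw, hwx⟩

theorem forall_mem_ball_neighborhood (M : LTS P I) (r : ℕ) (x : (M.neighborhood r).Dom) :
    x ∈ (M.neighborhood r).ball r :=
  mem_ball_neighborhood le_rfl x.2

theorem connected_neighborhood (M : LTS P I) (r : ℕ) : (M.neighborhood r).Connected :=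
  connected_of_forall_mem_ball (M.forall_mem_ball_neighborhood r)

theorem DegreeFinite.finite_neighborhood (hM : M.DegreeFinite) (r : ℕ) :
    Finite (M.neighborhood r).Dom :=
  (hM.finite_ball r).to_subtype

theorem IsHom.exists_lift_neighborhood {h : T.Dom → M.Dom} (hh : IsHom T M h) {r : ℕ}
    (hr : ∀ t, t ∈ T.ball r) :
    ∃ h' : T.Dom → (M.neighborhood r).Dom, IsHom T (M.neighborhood r) h' ∧ Subtype.val ∘ h' = h :=
  ⟨fun t => ⟨h t, hh.map_mem_ball (hr t)⟩, ⟨Subtype.ext hh.map_pt, hh.map_val, hh.map_rel⟩, rfl⟩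

theorem homCount_neighborhood (M : LTS P I) {r : ℕ} (hr : ∀ t, t ∈ T.ball r) :
    homCount T (M.neighborhood r) = homCount T M :=
  Set.BijOn.ncard_eq (f := (Subtype.val ∘ ·))
    ⟨fun _ hh => (M.val_mem_injHomSet_neighborhood r).1.comp hh,
      Subtype.val_injective.comp_left.injOn, fun _ hh => hh.exists_lift_neighborhood hr⟩

theorem nonempty_injHomSet_neighborhood {r : ℕ} (h : (InjHomSet (M.neighborhood r) N).Nonempty) :
    (InjHomSet (M.neighborhood r) (N.neighborhood r)).Nonempty := by
  obtain ⟨h, hh, hinj⟩ := h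
  obtain ⟨h', hh', rfl⟩ := hh.exists_lift_neighborhood (M.forall_mem_ball_neighborhood r)
  exact ⟨h', hh', hinj.of_comp⟩

/-- Every ball around the distinguished state of `M` has an injective homomorphism to `N`. Between
degree-finite structures, mutual local embeddability amounts to isomorphism of all balls. -/
def LocallyEmbeds (M N : LTS P I) : Prop := ∀ r, (InjHomSet (M.neighborhood r) N).Nonempty

theorem LocallyEmbeds.homCount_le (h : LocallyEmbeds M N) (hN : N.DegreeFinite) [Finite T.Dom]
    (hT : T.Connected) : homCount T M ≤ homCount T N := by
  obtain ⟨r, hr⟩ := hT.exists_forall_mem_ball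
  obtain ⟨u, hu⟩ := h r
  exact (homCount_neighborhood M hr).symm.trans_le
    (homCount_le_of_mem_injHomSet hu (hN.finite_homSet hT))

end InducedStructures

section Isomorphisms

variable {S T M N : LTS P I}

/-- Isomorphisms of pointed structures. -/
structure IsIso (S T : LTS P I) (e : S.Dom → T.Dom) : Prop where
  bijective : Function.Bijective e
  map_pt : e S.pt = T.pt
  val_iff : ∀ p s, T.val p (e s) ↔ S.val p s
  rel_iff : ∀ i s t, T.rel i (e s) (e t) ↔ S.rel i s t

theorem mem_of_apply_mem_of_mapsTo {α : Type*} {s : Set α} (hs : s.Finite) {f : α → α}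
    (hf : Function.Injective f) (hmaps : Set.MapsTo f s s) {x : α} (hx : f x ∈ s) : x ∈ s := by
  obtain ⟨y, hy, hyx⟩ := ((hs.injOn_iff_bijOn_of_mapsTo hmaps).1 hf.injOn).surjOn hx
  exact hf hyx ▸ hy

theorem isIso_of_mem_injHomSet [Finite S.Dom] {u : S.Dom → T.Dom} {v : T.Dom → S.Dom}
    (hu : u ∈ InjHomSet S T) (hv : v ∈ InjHomSet T S) : IsIso S T u where
  bijective := by
    have hvu : Function.Surjective (v ∘ u) := Finite.surjective_of_injective (hv.2.comp hu.2)
    exact ⟨hu.2, hvu.of_comp_left hv.2⟩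
  map_pt := hu.1.map_pt
  val_iff p s := by
    refine ⟨fun h => ?_, hu.1.map_val p s⟩
    exact mem_of_apply_mem_of_mapsTo (s := {s | S.val p s}) (Set.toFinite _) (hv.2.comp hu.2)
      (fun s => (hv.1.comp hu.1).map_val p s) (hv.1.map_val p _ h)
  rel_iff i s t := by
    refine ⟨fun h => ?_, hu.1.map_rel i s t⟩
    exact mem_of_apply_mem_of_mapsTo (s := {q : S.Dom × S.Dom | S.rel i q.1 q.2}) (x := (s, t))
      (Set.toFinite _) ((hv.2.comp hu.2).prodMap (hv.2.comp hu.2))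
      (fun q => (hv.1.comp hu.1).map_rel i q.1 q.2) (hv.1.map_rel i _ _ h)

theorem LocallyEmbeds.exists_isIso_neighborhood (hM : M.DegreeFinite) (hMN : LocallyEmbeds M N)
    (hNM : LocallyEmbeds N M) (r : ℕ) : ∃ e, IsIso (M.neighborhood r) (N.neighborhood r) e := by
  have := hM.finite_neighborhood r
  obtain ⟨u, hu⟩ := nonempty_injHomSet_neighborhood (hMN r)
  obtain ⟨v, hv⟩ := nonempty_injHomSet_neighborhood (hNM r)
  exact ⟨u, isIso_of_mem_injHomSet hu hv⟩

end Isomorphisms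

section InjectiveCounts

variable {T M N : LTS P I}

/-- The quotient of `T` by an equivalence relation, with the least structure that makes the
projection a homomorphism. -/
def quot (T : LTS P I) (θ : Setoid T.Dom) : LTS P I where
  Dom := Quotient θ
  val p x := ∃ s, Quotient.mk θ s = x ∧ T.val p s
  rel i x y := ∃ s t, Quotient.mk θ s = x ∧ Quotient.mk θ t = y ∧ T.rel i s t
  pt := Quotient.mk θ T.pt

theorem isHom_mk (T : LTS P I) (θ : Setoid T.Dom) : IsHom T (T.quot θ) (Quotient.mk θ) where
  map_pt := rfl
  map_val _ s h := ⟨s, rfl, h⟩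
  map_rel _ s t h := ⟨s, t, rfl, rfl, h⟩

theorem quot_mem_finiteConnected {T : LTS P I} (hT : T ∈ finiteConnected P I)
    (θ : Setoid T.Dom) : T.quot θ ∈ finiteConnected P I :=
  have := hT.1
  ⟨inferInstanceAs (Finite (Quotient θ)),
    (T.isHom_mk θ).connected_of_surjective Quotient.mk_surjective hT.2⟩

theorem IsHom.kerLift {h : T.Dom → M.Dom} (hh : IsHom T M h) :
    IsHom (T.quot (Setoid.ker h)) M (Setoid.kerLift h) where
  map_pt := hh.map_pt
  map_val := by
    rintro p _ ⟨s, rfl, hs⟩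
    exact hh.map_val p s hs
  map_rel := by
    rintro i _ _ ⟨s, t, rfl, rfl, hst⟩
    exact hh.map_rel i s t hst

theorem ker_comp_mk {α β : Type*} {θ : Setoid α} {f : Quotient θ → β}
    (hf : Function.Injective f) : Setoid.ker (f ∘ Quotient.mk θ) = θ :=
  Setoid.ext fun _ _ => hf.eq_iff.trans Quotient.eq

theorem ncard_homSet_ker_eq (T M : LTS P I) (θ : Setoid T.Dom) :
    {h ∈ HomSet T M | Setoid.ker h = θ}.ncard = (InjHomSet (T.quot θ) M).ncard := by
  symm
  refine Set.BijOn.ncard_eq (f := (· ∘ Quotient.mk θ)) ⟨?mapsTo, ?injOn, ?surjOn⟩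
  case mapsTo => exact fun h hh => ⟨hh.1.comp (T.isHom_mk θ), ker_comp_mk hh.2⟩
  case injOn => exact Quotient.mk_surjective.injective_comp_right.injOn
  case surjOn =>
    rintro h ⟨hh, rfl⟩
    exact ⟨Setoid.kerLift h, ⟨hh.kerLift, Setoid.kerLift_injective h⟩, rfl⟩

theorem finite_setoid (α : Type*) [Finite α] : Finite (Setoid α) :=
  Finite.of_injective (fun θ : Setoid α => θ.r) fun _ _ h => Setoid.ext fun a b =>
    iff_of_eq (congrFun₂ h a b)

theorem homCount_eq_ncard_injHomSet_add_finsum [Finite T.Dom] (hfin : (HomSet T M).Finite) :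
    homCount T M = (InjHomSet T M).ncard +
      ∑ᶠ θ ∈ ({⊥}ᶜ : Set (Setoid T.Dom)), (InjHomSet (T.quot θ) M).ncard := by
  have := finite_setoid T.Dom
  have hdiff : HomSet T M \ InjHomSet T M =
      ⋃ θ ∈ ({⊥}ᶜ : Set (Setoid T.Dom)), {h ∈ HomSet T M | Setoid.ker h = θ} := by
    ext h
    simp only [InjHomSet, HomSet, Set.mem_sdiff, Set.mem_ofPred_eq, Set.mem_iUnion,
      Set.mem_compl_iff, Set.mem_singleton_iff, ← Setoid.ker_eq_bot_iff]
    grind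
  rw [homCount, ← Set.ncard_sdiff_add_ncard_of_subset (T.injHomSet_subset_homSet M) hfin, add_comm,
    hdiff, Set.Finite.ncard_biUnion (Set.toFinite _) fun θ _ => hfin.sep _]
  · simp only [ncard_homSet_ker_eq]
  · exact fun θ _ θ' _ hne => Set.disjoint_left.2 fun h hθ hθ' => hne (hθ.2.symm.trans hθ'.2)

theorem card_quotient_lt {α : Type*} [Finite α] {θ : Setoid α} (hθ : θ ≠ ⊥) :
    Nat.card (Quotient θ) < Nat.card α := by
  refine (Nat.card_le_card_of_surjective _ Quotient.mk_surjective).lt_of_ne fun hcard => hθ ?_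
  have hbij := (Nat.bijective_iff_surjective_and_card _).2 ⟨Quotient.mk_surjective, hcard.symm⟩
  rw [← Setoid.ker_mk_eq θ, Setoid.ker_eq_bot_iff]
  exact hbij.1

theorem ncard_injHomSet_eq (hM : M.DegreeFinite) (hN : N.DegreeFinite)
    (h : ∀ T ∈ finiteConnected P I, homCount T M = homCount T N) (T : LTS P I)
    (hT : T ∈ finiteConnected P I) : (InjHomSet T M).ncard = (InjHomSet T N).ncard := by
  induction hn : Nat.card T.Dom using Nat.strong_induction_on generalizing T with | _ n ih
  have := hT.1
  have hquot : ∑ᶠ θ ∈ ({⊥}ᶜ : Set (Setoid T.Dom)), (InjHomSet (T.quot θ) M).ncard =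
      ∑ᶠ θ ∈ ({⊥}ᶜ : Set (Setoid T.Dom)), (InjHomSet (T.quot θ) N).ncard :=
    finsum_mem_congr rfl fun θ hθ =>
      ih _ (hn ▸ card_quotient_lt hθ) _ (quot_mem_finiteConnected hT θ) rfl
  have hcount := h T hT
  rwa [homCount_eq_ncard_injHomSet_add_finsum (hM.finite_homSet hT.2),
    homCount_eq_ncard_injHomSet_add_finsum (hN.finite_homSet hT.2), hquot,
    Nat.add_right_cancel_iff] at hcount

theorem exists_mem_finiteConnected_injHomSet {S : LTS P I} [Finite S.Dom] (hS : S.Connected) :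
    ∃ T ∈ finiteConnected P I, (InjHomSet S T).Nonempty ∧ (InjHomSet T S).Nonempty := by
  obtain ⟨n, ⟨e⟩⟩ := Finite.exists_equiv_fin S.Dom
  have he : IsHom S (S.comap e.symm (e S.pt)) e :=
    ⟨rfl, by simp [comap], by simp [comap]⟩
  exact ⟨S.comap e.symm (e S.pt),
    ⟨inferInstanceAs (Finite (Fin n)), he.connected_of_surjective e.surjective hS⟩,
    ⟨e, he, e.injective⟩, ⟨e.symm, isHom_comap (e.symm_apply_apply _), e.symm.injective⟩⟩

theorem locallyEmbeds_of_homCount_eq (hM : M.DegreeFinite) (hN : N.DegreeFinite)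
    (h : ∀ T ∈ finiteConnected P I, homCount T M = homCount T N) : LocallyEmbeds M N := by
  intro r
  have := hM.finite_neighborhood r
  obtain ⟨T, hT, ⟨f, hf⟩, ⟨g, hg⟩⟩ :=
    exists_mem_finiteConnected_injHomSet (M.connected_neighborhood r)
  have := hT.1
  have hfin : (InjHomSet T M).Finite :=
    (hM.finite_homSet hT.2).subset (T.injHomSet_subset_homSet M)
  have hTM : (InjHomSet T M).ncard ≠ 0 :=
    Set.ncard_ne_zero_of_mem (comp_mem_injHomSet (M.val_mem_injHomSet_neighborhood r) hg) hfin
  rw [ncard_injHomSet_eq hM hN h T hT] at hTM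
  obtain ⟨u, hu⟩ := Set.nonempty_of_ncard_ne_zero hTM
  exact ⟨u ∘ f, comp_mem_injHomSet hu hf⟩

end InjectiveCounts

end LTS

namespace HLB

open LTS

variable {P I : Type*}

section LocalInvariance

theorem sat_iff_of_isIso {S T : LTS P I} {e : S.Dom → T.Dom} (he : IsIso S T e) (φ : HLB P I)
    (s : S.Dom) (g : ℕ → S.Dom) : Sat T (e s) (e ∘ g) φ ↔ Sat S s g φ := by
  induction φ generalizing s g with
  | prop p => exact he.val_iff p s
  | wvar x => exact he.bijective.1.eq_iff
  | conj φ ψ ihφ ihψ => exact and_congr (ihφ s g) (ihψ s g)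
  | disj φ ψ ihφ ihψ => exact or_congr (ihφ s g) (ihψ s g)
  | neg _ ih => exact not_congr (ih s g)
  | dia i φ ih => simp only [Sat, he.bijective.2.exists, he.rel_iff, ih]
  | box i φ ih => simp only [Sat, he.bijective.2.forall, he.rel_iff, ih]
  | bdia i φ ih => simp only [Sat, he.bijective.2.exists, he.rel_iff, ih]
  | bind x φ ih => simp only [Sat, ← Function.comp_update, ih]
  | atVar x _ ih => exact ih (g x) g

theorem models_iff_of_isIso {S T : LTS P I} {e : S.Dom → T.Dom} (he : IsIso S T e)
    (φ : HLB P I) : Models T φ ↔ Models S φ := by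
  simp only [Models, he.bijective.2.comp_left.forall, ← he.map_pt, sat_iff_of_isIso he]

/-- The modal depth of a formula: the maximal number of nested modalities. The operator `@` does
not count, since it jumps to a state that has been visited before. -/
def depth : HLB P I → ℕ
  | prop _ => 0
  | wvar _ => 0
  | conj φ ψ => max φ.depth ψ.depth
  | disj φ ψ => max φ.depth ψ.depth
  | neg φ => φ.depth
  | dia _ φ => φ.depth + 1
  | box _ φ => φ.depth + 1
  | bdia _ φ => φ.depth + 1
  | bind _ φ => φ.depth
  | atVar _ φ => φ.depth

theorem exists_subtype_and_iff {α : Type*} {A : Set α} {R Q : α → Prop} {Q' : A → Prop}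
    (hR : ∀ t, R t → t ∈ A) (hQ : ∀ t : A, R t → (Q' t ↔ Q t)) :
    (∃ t : A, R t ∧ Q' t) ↔ ∃ t, R t ∧ Q t :=
  ⟨fun ⟨t, ht, h⟩ => ⟨t, ht, (hQ t ht).1 h⟩, fun ⟨t, ht, h⟩ => ⟨⟨t, hR t ht⟩, ht, (hQ _ ht).2 h⟩⟩

theorem forall_subtype_imp_iff {α : Type*} {A : Set α} {R Q : α → Prop} {Q' : A → Prop}
    (hR : ∀ t, R t → t ∈ A) (hQ : ∀ t : A, R t → (Q' t ↔ Q t)) :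
    (∀ t : A, R t → Q' t) ↔ ∀ t, R t → Q t :=
  ⟨fun h t ht => (hQ ⟨t, hR t ht⟩ ht).1 (h _ ht), fun h t ht => (hQ t ht).2 (h t ht)⟩

theorem sat_neighborhood_iff {M : LTS P I} {r n : ℕ} {φ : HLB P I} (hn : n + φ.depth ≤ r)
    {s : (M.neighborhood r).Dom} {g : ℕ → (M.neighborhood r).Dom} (hs : s.1 ∈ M.ball n)
    (hg : ∀ x, (g x).1 ∈ M.ball n) :
    Sat (M.neighborhood r) s g φ ↔ Sat M s.1 (Subtype.val ∘ g) φ := by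
  induction φ generalizing n s g with
  | prop p => rfl
  | wvar x => exact Subtype.val_injective.eq_iff.symm
  | conj φ ψ ihφ ihψ =>
    simp only [depth] at hn
    exact and_congr (ihφ (by lia) hs hg) (ihψ (by lia) hs hg)
  | disj φ ψ ihφ ihψ =>
    simp only [depth] at hn
    exact or_congr (ihφ (by lia) hs hg) (ihψ (by lia) hs hg)
  | neg _ ih => exact not_congr (ih hn hs hg)
  | dia i φ ih =>
    simp only [depth] at hn
    have hstep {t} (h : M.rel i s.1 t) : t ∈ M.ball (n + 1) := Step.mem_ball ⟨i, .inl h⟩ hs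
    exact exists_subtype_and_iff (fun t ht => M.ball_mono (by lia) (hstep ht)) fun t ht =>
      ih (by lia) (hstep ht) fun x => M.ball_mono n.le_succ (hg x)
  | box i φ ih =>
    simp only [depth] at hn
    have hstep {t} (h : M.rel i s.1 t) : t ∈ M.ball (n + 1) := Step.mem_ball ⟨i, .inl h⟩ hs
    exact forall_subtype_imp_iff (fun t ht => M.ball_mono (by lia) (hstep ht)) fun t ht =>
      ih (by lia) (hstep ht) fun x => M.ball_mono n.le_succ (hg x)
  | bdia i φ ih =>
    simp only [depth] at hn
    have hstep {t} (h : M.rel i t s.1) : t ∈ M.ball (n + 1) := Step.mem_ball ⟨i, .inr h⟩ hs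
    exact exists_subtype_and_iff (fun t ht => M.ball_mono (by lia) (hstep ht)) fun t ht =>
      ih (by lia) (hstep ht) fun x => M.ball_mono n.le_succ (hg x)
  | bind x φ ih =>
    have hupdate : ∀ y, (Function.update g x s y).1 ∈ M.ball n :=
      (Function.forall_update_iff g fun _ t => t.1 ∈ M.ball n).2 ⟨hs, fun y _ => hg y⟩
    exact (ih hn hs hupdate).trans
      (iff_of_eq (congrArg (Sat M s.1 · φ) (Function.comp_update Subtype.val g x s)))
  | atVar x _ ih => exact ih hn (hg x) hg

theorem models_neighborhood_iff (M : LTS P I) {φ : HLB P I} (hφ : φ.IsSentence) :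
    Models (M.neighborhood φ.depth) φ ↔ Models M φ := by
  rw [models_iff_sat _ φ hφ fun _ => (M.neighborhood φ.depth).pt,
    models_iff_sat M φ hφ fun _ => M.pt]
  exact sat_neighborhood_iff (n := 0) (zero_add φ.depth).le rfl fun _ => rfl

theorem equivalent_of_locallyEmbeds {M N : LTS P I} (hM : M.DegreeFinite)
    (hMN : LocallyEmbeds M N) (hNM : LocallyEmbeds N M) : Equivalent M N := by
  intro φ hφ
  obtain ⟨e, he⟩ := hMN.exists_isIso_neighborhood hM hNM φ.depth
  rw [← models_neighborhood_iff M hφ, ← models_iff_of_isIso he, models_neighborhood_iff N hφ]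

end LocalInvariance

section HennessyMilner

theorem finite_freeVars (φ : HLB P I) : φ.freeVars.Finite := by
  induction φ with
  | prop _ => exact Set.finite_empty
  | wvar x => exact Set.finite_singleton x
  | conj _ _ ihφ ihψ => exact ihφ.union ihψ
  | disj _ _ ihφ ihψ => exact ihφ.union ihψ
  | neg _ ih => exact ih
  | dia _ _ ih => exact ih
  | box _ _ ih => exact ih
  | bdia _ _ ih => exact ih
  | bind _ _ ih => exact ih.sdiff
  | atVar x _ ih => exact (Set.finite_singleton x).union ih

theorem freeVars_foldr_bind (l : List ℕ) (φ : HLB P I) :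
    (l.foldr bind φ).freeVars = φ.freeVars \ {x | x ∈ l} := by
  induction l with
  | nil => simp
  | cons x l ih =>
    ext y
    simp only [List.foldr_cons, freeVars, ih, List.mem_cons, Set.mem_sdiff, Set.mem_singleton_iff,
      Set.mem_ofPred_eq]
    tauto

theorem sat_foldr_bind_const (l : List ℕ) (φ : HLB P I) (M : LTS P I) (a : M.Dom) :
    Sat M a (fun _ => a) (l.foldr bind φ) ↔ Sat M a (fun _ => a) φ := by
  induction l with
  | nil => rfl
  | cons x l ih =>
    have hconst : Function.update (fun _ : ℕ => a) x a = fun _ => a :=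
      Function.update_eq_self x fun _ => a
    rw [List.foldr_cons, Sat, hconst, ih]

/-- The state `a` of `M` under the assignment `g` and the state `b` of `N` under the assignment `h`
satisfy the same formulas, with or without free world variables. -/
def SatEquiv (M N : LTS P I) (a : M.Dom) (g : ℕ → M.Dom) (b : N.Dom) (h : ℕ → N.Dom) : Prop :=
  ∀ φ : HLB P I, Sat M a g φ ↔ Sat N b h φ

variable {M N : LTS P I} {a a' : M.Dom} {g : ℕ → M.Dom} {b : N.Dom} {h : ℕ → N.Dom}

theorem Equivalent.symm (hMN : Equivalent M N) : Equivalent N M := fun φ hφ => (hMN φ hφ).symm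

theorem Equivalent.satEquiv (hMN : Equivalent M N) :
    SatEquiv M N M.pt (fun _ => M.pt) N.pt (fun _ => N.pt) := by
  intro φ
  have hclosed : (φ.finite_freeVars.toFinset.toList.foldr bind φ).IsSentence := by
    simp [IsSentence, freeVars_foldr_bind]
  rw [← sat_foldr_bind_const φ.finite_freeVars.toFinset.toList, ← models_iff_sat M _ hclosed,
    hMN _ hclosed, models_iff_sat N _ hclosed, sat_foldr_bind_const]

theorem exists_sat_forall_not_sat {B : Set N.Dom} (hB : B.Finite)
    (hdist : ∀ b ∈ B, ¬ SatEquiv M N a g b h) :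
    ∃ φ : HLB P I, Sat M a g φ ∧ ∀ b ∈ B, ¬ Sat N b h φ := by
  induction B, hB using Set.Finite.induction_on with
  | empty => exact ⟨bind 0 (wvar 0), Function.update_self .., fun _ => False.elim⟩
  | @insert b B _ _ ih =>
    obtain ⟨φ, hφ, hφB⟩ := ih fun b hb => hdist b (Or.inr hb)
    obtain ⟨ψ, hψ, hψb⟩ : ∃ ψ : HLB P I, Sat M a g ψ ∧ ¬ Sat N b h ψ := by
      obtain ⟨ψ, hψ⟩ := not_forall.1 (hdist b (Or.inl rfl))
      by_cases hψa : Sat M a g ψ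
      · exact ⟨ψ, hψa, fun hψb => hψ (iff_of_true hψa hψb)⟩
      · exact ⟨neg ψ, hψa, fun hψb => hψ (iff_of_false hψa hψb)⟩
    refine ⟨conj φ ψ, ⟨hφ, hψ⟩, ?_⟩
    rintro c (rfl | hc) ⟨hφc, hψc⟩
    exacts [hψb hψc, hφB c hc hφc]

namespace SatEquiv

theorem update (hab : SatEquiv M N a g b h) (x : ℕ) :
    SatEquiv M N a (Function.update g x a) b (Function.update h x b) :=
  fun φ => hab (bind x φ)

theorem jump (hab : SatEquiv M N a g b h) (x : ℕ) : SatEquiv M N (g x) g (h x) h :=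
  fun φ => hab (atVar x φ)

theorem exists_rel (hab : SatEquiv M N a g b h) (hN : N.DegreeFinite) {i : I}
    (hrel : M.rel i a a') : ∃ b', N.rel i b b' ∧ SatEquiv M N a' g b' h := by
  by_contra! hdist
  obtain ⟨φ, hφ, hφN⟩ := exists_sat_forall_not_sat (B := {b' | N.rel i b b'})
    ((hN b).1.subset fun _ hb' => ⟨i, hb'⟩) hdist
  obtain ⟨b', hb', hφb'⟩ := (hab (dia i φ)).1 ⟨a', hrel, hφ⟩
  exact hφN b' hb' hφb'

theorem exists_rel_swap (hab : SatEquiv M N a g b h) (hN : N.DegreeFinite) {i : I}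
    (hrel : M.rel i a' a) : ∃ b', N.rel i b' b ∧ SatEquiv M N a' g b' h := by
  by_contra! hdist
  obtain ⟨φ, hφ, hφN⟩ := exists_sat_forall_not_sat (B := {b' | N.rel i b' b})
    ((hN b).2.subset fun _ hb' => ⟨i, hb'⟩) hdist
  obtain ⟨b', hb', hφb'⟩ := (hab (bdia i φ)).1 ⟨a', hrel, hφ⟩
  exact hφN b' hb' hφb'

theorem exists_of_reflTransGen (hab : SatEquiv M N a g b h) (hN : N.DegreeFinite)
    (hpath : Relation.ReflTransGen M.Step a a') : ∃ b', SatEquiv M N a' g b' h := by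
  induction hpath with
  | refl => exact ⟨b, hab⟩
  | tail _ hstep ih =>
    obtain ⟨b', hb'⟩ := ih
    obtain ⟨i, hrel | hrel⟩ := hstep
    · exact (hb'.exists_rel hN hrel).imp fun _ => And.right
    · exact (hb'.exists_rel_swap hN hrel).imp fun _ => And.right

theorem eq_iff (hab : SatEquiv M N a g b h) (x y : ℕ) : g x = g y ↔ h x = h y :=
  hab (atVar y (wvar x))

theorem val_iff (hab : SatEquiv M N a g b h) (p : P) (x : ℕ) : M.val p (g x) ↔ N.val p (h x) :=
  hab (atVar x (prop p))

theorem rel_iff (hab : SatEquiv M N a g b h) (i : I) (x y : ℕ) :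
    M.rel i (g x) (g y) ↔ N.rel i (h x) (h y) := by
  simpa only [Sat, exists_eq_right'] using hab (atVar x (dia i (wvar y)))

theorem exists_update_of_reflTransGen (hgh : SatEquiv M N (g 0) g (h 0) h) (hN : N.DegreeFinite)
    (hpath : Relation.ReflTransGen M.Step (g 0) a) {x : ℕ} (hx : x ≠ 0) : ∃ b,
    SatEquiv M N (g 0) (Function.update g x a) (h 0) (Function.update h x b) := by
  obtain ⟨b, hb⟩ := hgh.exists_of_reflTransGen hN hpath
  have hjump := (hb.update x).jump 0
  simp only [Function.update_of_ne hx.symm] at hjump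
  exact ⟨b, hjump⟩

end SatEquiv

theorem Equivalent.exists_satEquiv_subset_image (hMN : Equivalent M N) (hN : N.DegreeFinite)
    {A : Set M.Dom} (hA : A.Finite) (hreach : ∀ a ∈ A, Relation.ReflTransGen M.Step M.pt a) :
    ∃ (g : ℕ → M.Dom) (h : ℕ → N.Dom) (V : Finset ℕ), g 0 = M.pt ∧ h 0 = N.pt ∧
      SatEquiv M N (g 0) g (h 0) h ∧ A ⊆ g '' V := by
  induction A, hA using Set.Finite.induction_on with
  | empty => exact ⟨fun _ => M.pt, fun _ => N.pt, ∅, rfl, rfl, hMN.satEquiv, Set.empty_subset _⟩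
  | @insert a A _ _ ih =>
    obtain ⟨g, h, V, hg0, hh0, hgh, hAV⟩ := ih fun a ha => hreach a (Or.inr ha)
    obtain ⟨x, hx⟩ := Infinite.exists_notMem_finset (insert 0 V)
    obtain ⟨hx0, hxV⟩ := not_or.1 (Finset.mem_insert.not.1 hx)
    obtain ⟨b, hb⟩ :=
      hgh.exists_update_of_reflTransGen hN (hg0 ▸ hreach a (Set.mem_insert a A)) hx0
    have hg0' : Function.update g x a 0 = g 0 := Function.update_of_ne (Ne.symm hx0) a g
    have hh0' : Function.update h x b 0 = h 0 := Function.update_of_ne (Ne.symm hx0) b h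
    refine ⟨Function.update g x a, Function.update h x b, insert x V, hg0'.trans hg0,
      hh0'.trans hh0, by rwa [hg0', hh0'], Set.insert_subset ?_ fun c hc => ?_⟩
    · exact ⟨x, Finset.mem_insert_self x V, Function.update_self x a g⟩
    · obtain ⟨y, hy, rfl⟩ := hAV hc
      exact ⟨y, Finset.mem_insert_of_mem hy,
        Function.update_of_ne (ne_of_mem_of_not_mem hy hxV) a g⟩

theorem Equivalent.locallyEmbeds (hMN : Equivalent M N) (hM : M.DegreeFinite)
    (hN : N.DegreeFinite) : LocallyEmbeds M N := by
  intro r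
  obtain ⟨g, h, V, hg0, hh0, hgh, hV⟩ := hMN.exists_satEquiv_subset_image hN (hM.finite_ball r)
    fun _ => reflTransGen_step_of_mem_ball
  choose x hx using fun s : M.ball r => Set.image_subset_range g V (hV s.2)
  refine ⟨h ∘ x, ⟨?map_pt, fun p s hs => ?map_val, fun i s t hst => ?map_rel⟩, fun s t hst => ?inj⟩
  case map_pt => exact ((hgh.eq_iff _ 0).1 ((hx _).trans hg0.symm)).trans hh0
  case map_val => exact (hgh.val_iff p (x s)).1 ((hx s).symm ▸ hs)
  case map_rel => exact (hgh.rel_iff i (x s) (x t)).1 ((hx s).symm ▸ (hx t).symm ▸ hst)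
  case inj =>
    have hg : g (x s) = g (x t) := (hgh.eq_iff _ _).2 hst
    exact Subtype.ext ((hx s).symm.trans (hg.trans (hx t)))

end HennessyMilner

end HLB

theorem mainTheorem7_general {P I : Type*} (M : LTS P I) (N : LTS P I)
    (hM : M.DegreeFinite) (hN : N.DegreeFinite) :
    (∀ T ∈ LTS.finiteConnected P I, (LTS.HomSet T M).Finite ∧ (LTS.HomSet T N).Finite) ∧
    (HLB.Equivalent M N ↔
      LTS.homVector (LTS.finiteConnected P I) M = LTS.homVector (LTS.finiteConnected P I) N) := by
  refine ⟨fun T hT => ?finite, fun h => ?homVector_eq, fun h => ?equivalent⟩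
  case finite =>
    have := hT.1
    exact ⟨hM.finite_homSet hT.2, hN.finite_homSet hT.2⟩
  case homVector_eq =>
    funext ⟨T, hfin, hT⟩
    exact le_antisymm ((h.locallyEmbeds hM hN).homCount_le hN hT)
      ((h.symm.locallyEmbeds hN hM).homCount_le hM hT)
  case equivalent =>
    have hcount (T) (hT : T ∈ LTS.finiteConnected P I) : LTS.homCount T M = LTS.homCount T N :=
      congrFun h ⟨T, hT⟩
    exact HLB.equivalent_of_locallyEmbeds hM (LTS.locallyEmbeds_of_homCount_eq hM hN hcount)
      (LTS.locallyEmbeds_of_homCount_eq hN hM fun T hT => (hcount T hT).symm)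

theorem mainTheorem7 {P I : Type*} [Finite P] [Finite I] (M : LTS P I) (N : LTS P I)
    (hM : M.DegreeFinite) (hN : N.DegreeFinite) :
    (∀ T ∈ LTS.finiteConnected P I, (LTS.HomSet T M).Finite ∧ (LTS.HomSet T N).Finite) ∧
    (HLB.Equivalent M N ↔
      LTS.homVector (LTS.finiteConnected P I) M = LTS.homVector (LTS.finiteConnected P I) N) :=
  mainTheorem7_general M N hM hN
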